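/- **Setting.** A finite PO-DTMC for $k$ agents is a tuple $M=(S,PI,PT,O_1,\dots,O_k,\pi)$ with $S$ a finite set of states, $PI$ a rational probability distribution on $S$, $PT$ a rational stochastic $S\times S$ matrix, observation functions $O_i$ on $S$, and $\pi(s)$ a finite set of atomic propositions for each $s\in S$. Its runs are the infinite sequences $r(0)r(1)\dots$ of states with $PI(r(0))>0$ and $PT(r(m),r(m+1))>0$ for all $m$; they carry the probability measure $\mu$ determined by $\mu(\{r : r(0)\dots r(m)=s_0\dots s_m\})=PI(s_0)\prod_{j<m}PT(s_j,s_{j+1})$. Formulas of the logic $\mathrm{WMLOKP}$ are built from time variables $t$ (ranging over $\mathbb N$) and set variables $X$ (ranging over finite subsets of $\mathbb N$) by $$\phi ::= p(t)\mid X(t)\mid t_1<t_2\mid f(P,\dots,P)\bowtie c\mid\neg\phi\mid\phi\wedge\phi\mid K_{i,t}(\phi)\mid\forall t(\phi)\mid\forall X(\phi),$$ where $p$ is an atomic proposition, $f$ is a rational polynomial, $c\in\mathbb Q$, ${\bowtie}\in\{=,<,\le,>,\ge\}$, and each probability term $P$ is either a global term $\Pr(\phi)$ or an agent term $\Pr_{i,t}(\phi)$.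 Formulas are interpreted on a run $r$ relative to an assignment $\tau$ of values to the variables: $p(t)$ holds if $p\in\pi(r(\tau(t)))$, the value of $\Pr(\phi)$ is the measure $\mu$ of the set of runs that satisfy $\phi$ under $\tau$, $K_{i,t}\phi$ and $\Pr_{i,t}(\phi)$ express knowledge and conditional probability given the local state of agent $i$ at time $\tau(t)$ (either with synchronous perfect recall or with the clock semantics), and the other constructs have their usual meaning. For a sentence $\phi$ (no free variables), $M\models\phi$ means that $\phi$ holds on all runs of $M$. Consider the fragment of $\mathrm{WMLOKP}$ without $K_{i,t}$ and $\Pr_{i,t}$, in which all probability comparisons have the form $a_1\Pr(\phi_1)+\dots+a_n\Pr(\phi_n)\bowtie c$ with $a_j,c\in\mathbb Q$, and in which quantifiers, in particular the second-order quantifiers $\forall X$, may bind variables inside probability terms ("quantifying-in"). **Theorem.** For every number $k$ of agents, and with either of the two semantics for agents, it is undecidable, given a finite PO-DTMC $M$ for $k$ agents and a sentence $\phi$ of this fragment, whether $M\models\phi$. -/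

import Mathlib

namespace WMLO

open MeasureTheory ProbabilityTheory

/-! ### Partially observed Markov chains -/

/-- A finite interpreted partially observed discrete-time Markov chain for `k` agents, presented as
a finite object: the states are `0, …, numStates - 1`, the probabilities are rational, observations
and atomic propositions are named by natural numbers, and each state satisfies finitely many
atomic propositions. -/
structure PODTMC (k : ℕ) where
  numStates : ℕ
  PI : Fin numStates → ℚ
  PI_nonneg : ∀ s, 0 ≤ PI s
  PI_sum : ∑ s, PI s = 1
  PT : Fin numStates → Fin numStates → ℚ
  PT_nonneg : ∀ s t, 0 ≤ PT s t
  PT_sum : ∀ s, ∑ t, PT s t = 1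
  obs : Fin k → Fin numStates → ℕ
  interp : Fin numStates → Finset ℕ

namespace PODTMC

variable {k : ℕ} (M : PODTMC k)

/-- The initial distribution as a probability mass function. -/
noncomputable def initPMF : PMF (Fin M.numStates) :=
  PMF.ofFintype (fun s => ENNReal.ofReal ((M.PI s : ℚ) : ℝ)) (by
    rw [← ENNReal.ofReal_sum_of_nonneg (fun s _ => by exact_mod_cast M.PI_nonneg s)]
    have h : ∑ s, ((M.PI s : ℚ) : ℝ) = 1 := by exact_mod_cast M.PI_sum
    rw [h, ENNReal.ofReal_one])

/-- The distribution of the successor of the state `s`. -/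
noncomputable def stepPMF (s : Fin M.numStates) : PMF (Fin M.numStates) :=
  PMF.ofFintype (fun t => ENNReal.ofReal ((M.PT s t : ℚ) : ℝ)) (by
    rw [← ENNReal.ofReal_sum_of_nonneg (fun t _ => by exact_mod_cast M.PT_nonneg s t)]
    have h : ∑ t, ((M.PT s t : ℚ) : ℝ) = 1 := by exact_mod_cast M.PT_sum s
    rw [h, ENNReal.ofReal_one])

/-- The one-step transition kernel. -/
noncomputable def stepKernel : Kernel (Fin M.numStates) (Fin M.numStates) :=
  Kernel.ofFunOfCountable (fun s => (M.stepPMF s).toMeasure)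

instance : IsMarkovKernel M.stepKernel :=
  ⟨fun s => by
    change IsProbabilityMeasure (M.stepPMF s).toMeasure
    infer_instance⟩

/-- The transition kernel from histories up to time `m` to the state at time `m + 1`. -/
noncomputable def histKernel (m : ℕ) :
    Kernel (Π _ : Finset.Iic m, Fin M.numStates) (Fin M.numStates) :=
  M.stepKernel.comap (fun h => h ⟨m, Finset.mem_Iic.2 le_rfl⟩) (measurable_pi_apply _)

instance (m : ℕ) : IsMarkovKernel (M.histKernel m) := by
  unfold histKernel
  infer_instance

/-- The law of the chain on the space of all infinite sequences of states, which carries the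
product `σ`-algebra. -/
noncomputable def seqMeasure : Measure (ℕ → Fin M.numStates) :=
  Kernel.trajMeasure (X := fun _ => Fin M.numStates) M.initPMF.toMeasure M.histKernel

/-- The infinite paths: sequences of states all of whose transitions have positive probability and
whose first state has positive initial probability. -/
abbrev Path : Type :=
  {ρ : ℕ → Fin M.numStates // M.PI (ρ 0) ≠ 0 ∧ ∀ m, 0 < M.PT (ρ m) (ρ (m + 1))}

/-- The probability measure on the infinite paths. The `σ`-algebra on paths is the trace of the
product `σ`-algebra, that is, it is generated by the sets of paths with a given finite prefix. -/
noncomputable def pathMeasure : Measure M.Path :=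
  M.seqMeasure.comap Subtype.val

end PODTMC

/-! ### Local states of the agents -/

/-- What agents remember: synchronous perfect recall or clock semantics. -/
inductive Recall
  | spr
  | clk

namespace PODTMC

variable {k : ℕ} (M : PODTMC k)

/-- The local state of agent `i` at time `m` on the path `ρ`: with perfect recall, the sequence of
all observations made so far; in the clock semantics, the time and the current observation. -/
def localState (x : Recall) (i : Fin k) (ρ : M.Path) (m : ℕ) : List ℕ :=
  match x with
  | .spr => (List.range (m + 1)).map (fun j => M.obs i (ρ.1 j))
  | .clk => [m, M.obs i (ρ.1 m)]

end PODTMC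

/-! ### Syntax -/

/-- The comparison symbols. -/
inductive Cmp
  | eq
  | lt
  | le
  | gt
  | ge

mutual

/-- Formulas of the weak monadic second order logic of order, knowledge and probability for `k`
agents. Atomic propositions, time variables and set variables are named by natural numbers; time
variables and set variables are two separate sorts. -/
inductive Formula (k : ℕ) : Type
  /-- `p(t)` for an atomic proposition `p` -/
  | prop (p t : ℕ) : Formula k
  /-- `X(t)` for a set variable `X` -/
  | mem (X t : ℕ) : Formula k
  /-- `t < u` -/
  | lt (t u : ℕ) : Formula k
  /-- `f(P, …, P) ⋈ c` for a rational constant `c` -/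
  | cmp (e : PExpr k) (r : Cmp) (c : ℚ) : Formula k
  | neg (φ : Formula k) : Formula k
  | and (φ ψ : Formula k) : Formula k
  /-- `K_{i,t} φ` -/
  | know (i : Fin k) (t : ℕ) (φ : Formula k) : Formula k
  /-- `∀ t φ` for a time variable `t` -/
  | allTime (t : ℕ) (φ : Formula k) : Formula k
  /-- `∀ X φ` for a set variable `X` -/
  | allSet (X : ℕ) (φ : Formula k) : Formula k

/-- Probability expressions `f(P, …, P)`: polynomials with rational coefficients in probability
terms, built from constants and probability terms by addition and multiplication. -/
inductive PExpr (k : ℕ) : Type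
  | const (q : ℚ) : PExpr k
  /-- the global probability term `Pr(φ)` -/
  | pr (φ : Formula k) : PExpr k
  /-- the agent probability term `Pr_{i,t}(φ)` -/
  | prAgent (i : Fin k) (t : ℕ) (φ : Formula k) : PExpr k
  | add (e₁ e₂ : PExpr k) : PExpr k
  | mul (e₁ e₂ : PExpr k) : PExpr k

end

mutual

/-- The time variables that occur free. -/
def Formula.freeTime {k : ℕ} : Formula k → Finset ℕ
  | .prop _ t => {t}
  | .mem _ t => {t}
  | .lt t u => {t, u}
  | .cmp e _ _ => e.freeTime
  | .neg φ => φ.freeTime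
  | .and φ ψ => φ.freeTime ∪ ψ.freeTime
  | .know _ t φ => insert t φ.freeTime
  | .allTime t φ => φ.freeTime.erase t
  | .allSet _ φ => φ.freeTime

/-- The time variables that occur free in a probability expression. -/
def PExpr.freeTime {k : ℕ} : PExpr k → Finset ℕ
  | .const _ => ∅
  | .pr φ => φ.freeTime
  | .prAgent _ t φ => insert t φ.freeTime
  | .add e₁ e₂ => e₁.freeTime ∪ e₂.freeTime
  | .mul e₁ e₂ => e₁.freeTime ∪ e₂.freeTime

end

mutual

/-- The set variables that occur free. -/
def Formula.freeSet {k : ℕ} : Formula k → Finset ℕ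
  | .prop _ _ => ∅
  | .mem X _ => {X}
  | .lt _ _ => ∅
  | .cmp e _ _ => e.freeSet
  | .neg φ => φ.freeSet
  | .and φ ψ => φ.freeSet ∪ ψ.freeSet
  | .know _ _ φ => φ.freeSet
  | .allTime _ φ => φ.freeSet
  | .allSet X φ => φ.freeSet.erase X

/-- The set variables that occur free in a probability expression. -/
def PExpr.freeSet {k : ℕ} : PExpr k → Finset ℕ
  | .const _ => ∅
  | .pr φ => φ.freeSet
  | .prAgent _ _ φ => φ.freeSet
  | .add e₁ e₂ => e₁.freeSet ∪ e₂.freeSet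
  | .mul e₁ e₂ => e₁.freeSet ∪ e₂.freeSet

end

/-- A sentence is a formula without free variables of either sort. -/
def Formula.IsSentence {k : ℕ} (φ : Formula k) : Prop :=
  φ.freeTime = ∅ ∧ φ.freeSet = ∅

mutual

/-- The fragment without knowledge operators in which every probability comparison is between a
linear combination of global probability terms `Pr(φ)` and a constant. Quantifiers of both sorts may
occur anywhere; in particular a set quantifier may bind occurrences inside probability terms. -/
def Formula.LinearGlobal {k : ℕ} : Formula k → Prop
  | .prop _ _ => True
  | .mem _ _ => True
  | .lt _ _ => True
  | .cmp e _ _ => e.LinearGlobal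
  | .neg φ => φ.LinearGlobal
  | .and φ ψ => φ.LinearGlobal ∧ ψ.LinearGlobal
  | .know _ _ _ => False
  | .allTime _ φ => φ.LinearGlobal
  | .allSet _ φ => φ.LinearGlobal

/-- Linear combinations, with rational coefficients, of terms `Pr(φ)` with `φ` in the fragment. -/
def PExpr.LinearGlobal {k : ℕ} : PExpr k → Prop
  | .pr φ => φ.LinearGlobal
  | .add e₁ e₂ => e₁.LinearGlobal ∧ e₂.LinearGlobal
  | .mul (.const _) e => e.LinearGlobal
  | .mul _ _ => False
  | .const _ => False
  | .prAgent _ _ _ => False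

end

/-! ### Semantics -/

/-- The meaning of a comparison symbol. -/
def Cmp.Holds : Cmp → ℝ → ℝ → Prop
  | .eq, a, b => a = b
  | .lt, a, b => a < b
  | .le, a, b => a ≤ b
  | .gt, a, b => a > b
  | .ge, a, b => a ≥ b

/-- An assignment of natural numbers to time variables and of finite sets of natural numbers to set
variables. -/
structure Assignment where
  time : ℕ → ℕ
  set : ℕ → Finset ℕ

/-- `τ[t ↦ n]` for a time variable. -/
def Assignment.updTime (τ : Assignment) (t n : ℕ) : Assignment :=
  ⟨Function.update τ.time t n, τ.set⟩

/-- `τ[X ↦ U]` for a set variable. -/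
def Assignment.updSet (τ : Assignment) (X : ℕ) (U : Finset ℕ) : Assignment :=
  ⟨τ.time, Function.update τ.set X U⟩

mutual

/-- Satisfaction of a formula on the run given by the path `ρ`. -/
noncomputable def Formula.Sat {k : ℕ} (M : PODTMC k) (x : Recall) : Formula k → Assignment → M.Path → Prop
  | .prop p t, τ, ρ => p ∈ M.interp (ρ.1 (τ.time t))
  | .mem X t, τ, _ => τ.time t ∈ τ.set X
  | .lt t u, τ, _ => τ.time t < τ.time u
  | .cmp e r c, τ, ρ => r.Holds (e.val M x τ ρ) (c : ℝ)
  | .neg φ, τ, ρ => ¬ φ.Sat M x τ ρ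
  | .and φ ψ, τ, ρ => φ.Sat M x τ ρ ∧ ψ.Sat M x τ ρ
  | .know i t φ, τ, ρ => ∀ (ρ' : M.Path) (m' : ℕ),
      M.localState x i ρ' m' = M.localState x i ρ (τ.time t) → φ.Sat M x τ ρ'
  | .allTime t φ, τ, ρ => ∀ n : ℕ, φ.Sat M x (τ.updTime t n) ρ
  | .allSet X φ, τ, ρ => ∀ U : Finset ℕ, φ.Sat M x (τ.updSet X U) ρ

/-- The value of a probability expression on the run given by the path `ρ`. -/
noncomputable def PExpr.val {k : ℕ} (M : PODTMC k) (x : Recall) :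
    PExpr k → Assignment → M.Path → ℝ
  | .const q, _, _ => (q : ℝ)
  | .pr φ, τ, _ => M.pathMeasure.real {ρ' | φ.Sat M x τ ρ'}
  | .prAgent i t φ, τ, ρ =>
      M.pathMeasure.real {ρ' | M.localState x i ρ (τ.time t) = M.localState x i ρ' (τ.time t) ∧
          φ.Sat M x τ ρ'} /
        M.pathMeasure.real {ρ' | M.localState x i ρ (τ.time t) = M.localState x i ρ' (τ.time t)}
  | .add e₁ e₂, τ, ρ => e₁.val M x τ ρ + e₂.val M x τ ρ
  | .mul e₁ e₂, τ, ρ => e₁.val M x τ ρ * e₂.val M x τ ρ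

end

/-- `M ⊨ φ`: the formula holds on all runs. For a sentence the assignment is irrelevant. -/
def PODTMC.Models {k : ℕ} (M : PODTMC k) (x : Recall) (φ : Formula k) : Prop :=
  ∀ (τ : Assignment) (ρ : M.Path), φ.Sat M x τ ρ

/-! ### Finite descriptions, as inputs of algorithms -/

/-- The code of a rational number: its numerator and denominator in lowest terms. -/
def ratCode (q : ℚ) : ℕ := Nat.pair (Encodable.encode q.num) q.den

/-- The code of a comparison symbol. -/
def Cmp.code : Cmp → ℕ
  | .eq => 0
  | .lt => 1
  | .le => 2
  | .gt => 3
  | .ge => 4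

/-- The description of a chain: the number of states, and the tables of the initial distribution, of
the transition probabilities, of the observations of each agent, and of the atomic propositions that
hold at each state. -/
def PODTMC.code {k : ℕ} (M : PODTMC k) :
    ℕ × List ℕ × List (List ℕ) × List (List ℕ) × List (List ℕ) :=
  (M.numStates,
    List.ofFn (fun s => ratCode (M.PI s)),
    List.ofFn (fun s => List.ofFn (fun t => ratCode (M.PT s t))),
    List.ofFn (fun i => List.ofFn (fun s => M.obs i s)),
    List.ofFn (fun s => (M.interp s).sort (· ≤ ·)))

mutual

/-- The Gödel number of a formula. -/
def Formula.code {k : ℕ} : Formula k → ℕ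
  | .prop p t => Nat.pair 0 (Nat.pair p t)
  | .mem X t => Nat.pair 1 (Nat.pair X t)
  | .lt t u => Nat.pair 2 (Nat.pair t u)
  | .cmp e r c => Nat.pair 3 (Nat.pair e.code (Nat.pair r.code (ratCode c)))
  | .neg φ => Nat.pair 4 φ.code
  | .and φ ψ => Nat.pair 5 (Nat.pair φ.code ψ.code)
  | .know i t φ => Nat.pair 6 (Nat.pair i (Nat.pair t φ.code))
  | .allTime t φ => Nat.pair 7 (Nat.pair t φ.code)
  | .allSet X φ => Nat.pair 8 (Nat.pair X φ.code)

/-- The Gödel number of a probability expression. -/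
def PExpr.code {k : ℕ} : PExpr k → ℕ
  | .const q => Nat.pair 0 (ratCode q)
  | .pr φ => Nat.pair 1 φ.code
  | .prAgent i t φ => Nat.pair 2 (Nat.pair i (Nat.pair t φ.code))
  | .add e₁ e₂ => Nat.pair 3 (Nat.pair e₁.code e₂.code)
  | .mul e₁ e₂ => Nat.pair 4 (Nat.pair e₁.code e₂.code)

end

end WMLO

namespace WMLO

open MeasureTheory ProbabilityTheory

namespace PODTMC

variable {k : ℕ} (M : PODTMC k)

instance : IsProbabilityMeasure M.seqMeasure := by
  unfold seqMeasure
  infer_instance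

theorem seqMeasure_zero (s : Fin M.numStates) :
    M.seqMeasure {ω | ω 0 = s} = ENNReal.ofReal ((M.PI s : ℚ) : ℝ) := by
  have h : M.seqMeasure.map (fun ω => ω 0) = M.initPMF.toMeasure := by
    have h1 : M.seqMeasure.map (Preorder.frestrictLe (π := fun _ => Fin M.numStates) 0) =
        M.initPMF.toMeasure.map (MeasurableEquiv.piUnique
          (fun _ : Finset.Iic 0 => Fin M.numStates)).symm := by
      unfold seqMeasure Kernel.trajMeasure
      rw [Measure.map_comp _ _ (by fun_prop), Kernel.traj_map_frestrictLe,
        Kernel.partialTraj_self, Measure.id_comp]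
    have h2 := congrArg (Measure.map (fun h : (Finset.Iic 0 → Fin M.numStates) =>
      h ⟨0, Finset.mem_Iic.2 le_rfl⟩)) h1
    rw [Measure.map_map (by fun_prop) (by fun_prop),
      Measure.map_map (by fun_prop) (by fun_prop)] at h2
    refine h2.trans ?_
    exact Measure.map_id
  have h3 := congrArg (fun μ : Measure (Fin M.numStates) => μ {s}) h
  beta_reduce at h3
  rw [Measure.map_apply (by fun_prop) (by measurability),
    PMF.toMeasure_apply_singleton _ _ (by measurability)] at h3
  exact h3

/-- The probability that the chain follows a given finite sequence of states. -/
theorem seqMeasure_cylinder (ρ : ℕ → Fin M.numStates) (m : ℕ) :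
    M.seqMeasure {ω | ∀ j ≤ m, ω j = ρ j} =
      ENNReal.ofReal (((M.PI (ρ 0) * ∏ j ∈ Finset.range m, M.PT (ρ j) (ρ (j + 1)) : ℚ)) : ℝ) := by
  induction m with
  | zero =>
    simpa using M.seqMeasure_zero (ρ 0)
  | succ m ih =>
    have h := Kernel.map_frestrictLe_trajMeasure_compProd_eq_map_trajMeasure
      (X := fun _ => Fin M.numStates) (μ₀ := M.initPMF.toMeasure) (κ := M.histKernel) (a := m)
    set S : Set (Finset.Iic m → Fin M.numStates) :=
      {(fun j => ρ j : Finset.Iic m → Fin M.numStates)} with hS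
    have hSm : MeasurableSet S := MeasurableSet.of_discrete
    have h2 := congrArg (fun μ : Measure ((Finset.Iic m → Fin M.numStates) × Fin M.numStates) =>
      μ (S ×ˢ {ρ (m + 1)})) h
    beta_reduce at h2
    rw [Measure.compProd_apply_prod hSm (by measurability),
      Measure.map_apply (by fun_prop) (by measurability)] at h2
    have e1 : (fun x : ℕ → Fin M.numStates =>
        (Preorder.frestrictLe (π := fun _ => Fin M.numStates) m x, x (m + 1))) ⁻¹'
          (S ×ˢ {ρ (m + 1)}) = {ω | ∀ j ≤ m + 1, ω j = ρ j} := by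
      ext ω
      simp only [hS, Set.mem_preimage, Set.mem_prod, Set.mem_singleton_iff, Set.mem_ofPred_eq]
      constructor
      · rintro ⟨h1, h2⟩ j hj
        rcases Nat.lt_or_ge m j with h3 | h3
        · obtain rfl : j = m + 1 := by omega
          exact h2
        · exact congrFun h1 ⟨j, Finset.mem_Iic.2 h3⟩
      · intro h1
        refine ⟨?_, h1 _ le_rfl⟩
        funext j
        exact h1 j ((Finset.mem_Iic.1 j.2).trans (Nat.le_succ m))
    have e2 : (Preorder.frestrictLe (π := fun _ => Fin M.numStates) m) ⁻¹' S =
        {ω | ∀ j ≤ m, ω j = ρ j} := by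
      ext ω
      simp only [hS, Set.mem_preimage, Set.mem_singleton_iff, Set.mem_ofPred_eq]
      constructor
      · intro h1 j hj
        exact congrFun h1 ⟨j, Finset.mem_Iic.2 hj⟩
      · intro h1
        funext j
        exact h1 j (Finset.mem_Iic.1 j.2)
    rw [e1] at h2
    change _ = M.seqMeasure _ at h2
    rw [← h2, hS, lintegral_singleton, Measure.map_apply (by fun_prop) (by measurability), ← hS, e2]
    change _ * M.seqMeasure _ = _
    rw [ih]
    have e3 : M.histKernel m (fun j => ρ j) {ρ (m + 1)} =
        ENNReal.ofReal ((M.PT (ρ m) (ρ (m + 1)) : ℚ) : ℝ) := by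
      change (M.stepPMF (ρ m)).toMeasure {ρ (m + 1)} = _
      rw [PMF.toMeasure_apply_singleton _ _ (by measurability)]
      rfl
    rw [e3, ← ENNReal.ofReal_mul (by exact_mod_cast M.PT_nonneg _ _), Finset.prod_range_succ]
    congr 1
    push_cast
    ring

theorem measurableSet_path :
    MeasurableSet {ρ : ℕ → Fin M.numStates |
      M.PI (ρ 0) ≠ 0 ∧ ∀ m, 0 < M.PT (ρ m) (ρ (m + 1))} := by
  have h0 : MeasurableSet {ρ : ℕ → Fin M.numStates | M.PI (ρ 0) ≠ 0} :=
    measurableSet_preimage (f := fun ρ : ℕ → Fin M.numStates => ρ 0) (measurable_pi_apply 0)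
      (MeasurableSet.of_discrete (s := {s | M.PI s ≠ 0}))
  have h1 : ∀ m, MeasurableSet {ρ : ℕ → Fin M.numStates | 0 < M.PT (ρ m) (ρ (m + 1))} := fun m =>
    measurableSet_preimage (f := fun ρ : ℕ → Fin M.numStates => (ρ m, ρ (m + 1)))
      ((measurable_pi_apply m).prodMk (measurable_pi_apply (m + 1)))
      (MeasurableSet.of_discrete (s := {p : Fin M.numStates × Fin M.numStates | 0 < M.PT p.1 p.2}))
  rw [Set.ofPred_and, Set.ofPred_forall]
  exact h0.inter (MeasurableSet.iInter h1)

/-- Almost every sequence of states is a path. -/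
theorem ae_path : ∀ᵐ ρ ∂M.seqMeasure,
    M.PI (ρ 0) ≠ 0 ∧ ∀ m, 0 < M.PT (ρ m) (ρ (m + 1)) := by
  have key : ∀ (m : ℕ) (f : (Finset.Iic (m + 1) → Fin M.numStates)),
      ∀ᵐ ω ∂M.seqMeasure, (∀ j : Finset.Iic (m + 1), ω j = f j) →
        M.PI (ω 0) ≠ 0 ∧ 0 < M.PT (ω m) (ω (m + 1)) := by
    intro m f
    by_cases hf : M.PI (f ⟨0, by simp⟩) ≠ 0 ∧ 0 < M.PT (f ⟨m, by simp⟩) (f ⟨m + 1, by simp⟩)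
    · refine Filter.Eventually.of_forall fun ω hω => ?_
      rw [← hω, ← hω, ← hω] at hf
      exact hf
    · set ρ : ℕ → Fin M.numStates := fun j =>
        if hj : j ≤ m + 1 then f ⟨j, Finset.mem_Iic.2 hj⟩ else f ⟨0, by simp⟩ with hρ
      have hz : M.PI (ρ 0) * ∏ j ∈ Finset.range (m + 1), M.PT (ρ j) (ρ (j + 1)) = 0 := by
        have r0 : ρ 0 = f ⟨0, by simp⟩ := by simp [hρ]
        have r1 : ρ m = f ⟨m, by simp⟩ := by simp [hρ]
        have r2 : ρ (m + 1) = f ⟨m + 1, by simp⟩ := by simp [hρ]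
        rw [← r0, ← r1, ← r2, not_and_or] at hf
        rcases hf with hf | hf
        · rw [not_not.1 hf, zero_mul]
        · rw [Finset.prod_range_succ, le_antisymm (not_lt.1 hf) (M.PT_nonneg _ _), mul_zero,
            mul_zero]
      have hc := M.seqMeasure_cylinder ρ (m + 1)
      rw [hz] at hc
      simp only [Rat.cast_zero, ENNReal.ofReal_zero] at hc
      rw [ae_iff]
      refine measure_mono_null ?_ hc
      intro ω hω j hj
      simp only [Set.mem_ofPred_eq, Classical.not_imp] at hω
      rw [hω.1 ⟨j, Finset.mem_Iic.2 hj⟩]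
      simp [hρ, hj]
  have key2 : ∀ m : ℕ, ∀ᵐ ω ∂M.seqMeasure, M.PI (ω 0) ≠ 0 ∧ 0 < M.PT (ω m) (ω (m + 1)) := by
    intro m
    filter_upwards [ae_all_iff.2 (key m)] with ω hω
    exact hω (fun j => ω j) (fun _ => rfl)
  filter_upwards [ae_all_iff.2 key2] with ω hω
  exact ⟨(hω 0).1, fun m => (hω m).2⟩

theorem pathMeasure_apply (A : Set (ℕ → Fin M.numStates)) :
    M.pathMeasure {ρ | ρ.1 ∈ A} = M.seqMeasure A := by
  unfold pathMeasure
  have e : MeasurableEmbedding (Subtype.val : M.Path → ℕ → Fin M.numStates) :=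
    MeasurableEmbedding.subtype_coe M.measurableSet_path
  rw [e.comap_apply]
  refine measure_congr ?_
  filter_upwards [M.ae_path] with ρ hρ
  apply propext
  constructor
  · rintro ⟨ω, hω, rfl⟩
    exact hω
  · intro h
    exact ⟨⟨ρ, hρ⟩, h, rfl⟩

instance : IsProbabilityMeasure M.pathMeasure :=
  ⟨by simpa using M.pathMeasure_apply Set.univ⟩

/-- The probability of the set of paths with a given finite prefix. -/
theorem pathMeasure_cylinder (ρ : M.Path) (m : ℕ) :
    M.pathMeasure {ω | ∀ j ≤ m, ω.1 j = ρ.1 j} =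
      ENNReal.ofReal
        (((M.PI (ρ.1 0) * ∏ j ∈ Finset.range m, M.PT (ρ.1 j) (ρ.1 (j + 1)) : ℚ)) : ℝ) :=
  (M.pathMeasure_apply {ω | ∀ j ≤ m, ω j = ρ.1 j}).trans (M.seqMeasure_cylinder ρ.1 m)

end PODTMC

theorem ratCode_injective : Function.Injective ratCode := by
  intro p q h
  simp only [ratCode, Nat.pair_eq_pair, Encodable.encode_inj] at h
  exact Rat.ext h.1 h.2

theorem Cmp.code_injective : Function.Injective Cmp.code := by
  intro a b h
  cases a <;> cases b <;> simp_all [Cmp.code]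

/-- A chain is determined by its code. -/
theorem PODTMC.code_injective {k : ℕ} : Function.Injective (PODTMC.code (k := k)) := by
  rintro ⟨n, PI, h1, h2, PT, h3, h4, O, I⟩ ⟨n', PI', h1', h2', PT', h3', h4', O', I'⟩ h
  simp only [PODTMC.code, Prod.mk.injEq] at h
  obtain ⟨rfl, hPI, hPT, hO, hI⟩ := h
  rw [List.ofFn_inj] at hPI hPT hO hI
  have e1 : PI = PI' := funext fun s => ratCode_injective (congrFun hPI s)
  have e2 : PT = PT' := funext fun s => funext fun t => by
    have := congrFun hPT s
    rw [List.ofFn_inj] at this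
    exact ratCode_injective (congrFun this t)
  have e3 : O = O' := funext fun i => by
    have := congrFun hO i
    rwa [List.ofFn_inj] at this
  have e4 : I = I' := funext fun s => by
    have := congrArg List.toFinset (congrFun hI s)
    simpa using this
  subst e1 e2 e3 e4
  rfl

mutual

/-- A formula is determined by its code. -/
theorem Formula.code_inj {k : ℕ} : ∀ φ ψ : Formula k, φ.code = ψ.code → φ = ψ
  | .prop _ _, ψ, h => by
    cases ψ <;> simp_all [Formula.code, Nat.pair_eq_pair]
  | .mem _ _, ψ, h => by
    cases ψ <;> simp_all [Formula.code, Nat.pair_eq_pair]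
  | .lt _ _, ψ, h => by
    cases ψ <;> simp_all [Formula.code, Nat.pair_eq_pair]
  | .cmp e r c, ψ, h => by
    cases ψ with
    | cmp e' r' c' =>
      simp only [Formula.code, Nat.pair_eq_pair, true_and] at h
      rw [PExpr.code_inj e e' h.1, Cmp.code_injective h.2.1, ratCode_injective h.2.2]
    | _ => simp [Formula.code, Nat.pair_eq_pair] at h
  | .neg φ, ψ, h => by
    cases ψ with
    | neg φ' =>
      simp only [Formula.code, Nat.pair_eq_pair, true_and] at h
      rw [Formula.code_inj φ φ' h]
    | _ => simp [Formula.code, Nat.pair_eq_pair] at h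
  | .and φ χ, ψ, h => by
    cases ψ with
    | and φ' χ' =>
      simp only [Formula.code, Nat.pair_eq_pair, true_and] at h
      rw [Formula.code_inj φ φ' h.1, Formula.code_inj χ χ' h.2]
    | _ => simp [Formula.code, Nat.pair_eq_pair] at h
  | .know i t φ, ψ, h => by
    cases ψ with
    | know i' t' φ' =>
      simp only [Formula.code, Nat.pair_eq_pair, true_and] at h
      rw [Fin.ext h.1, h.2.1, Formula.code_inj φ φ' h.2.2]
    | _ => simp [Formula.code, Nat.pair_eq_pair] at h
  | .allTime t φ, ψ, h => by
    cases ψ with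
    | allTime t' φ' =>
      simp only [Formula.code, Nat.pair_eq_pair, true_and] at h
      rw [h.1, Formula.code_inj φ φ' h.2]
    | _ => simp [Formula.code, Nat.pair_eq_pair] at h
  | .allSet X φ, ψ, h => by
    cases ψ with
    | allSet X' φ' =>
      simp only [Formula.code, Nat.pair_eq_pair, true_and] at h
      rw [h.1, Formula.code_inj φ φ' h.2]
    | _ => simp [Formula.code, Nat.pair_eq_pair] at h

/-- A probability expression is determined by its code. -/
theorem PExpr.code_inj {k : ℕ} : ∀ e f : PExpr k, e.code = f.code → e = f
  | .const p, f, h => by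
    cases f with
    | const q =>
      simp only [PExpr.code, Nat.pair_eq_pair, true_and] at h
      rw [ratCode_injective h]
    | _ => simp [PExpr.code, Nat.pair_eq_pair] at h
  | .pr φ, f, h => by
    cases f with
    | pr φ' =>
      simp only [PExpr.code, Nat.pair_eq_pair, true_and] at h
      rw [Formula.code_inj φ φ' h]
    | _ => simp [PExpr.code, Nat.pair_eq_pair] at h
  | .prAgent i t φ, f, h => by
    cases f with
    | prAgent i' t' φ' =>
      simp only [PExpr.code, Nat.pair_eq_pair, true_and] at h
      rw [Fin.ext h.1, h.2.1, Formula.code_inj φ φ' h.2.2]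
    | _ => simp [PExpr.code, Nat.pair_eq_pair] at h
  | .add a b, f, h => by
    cases f with
    | add a' b' =>
      simp only [PExpr.code, Nat.pair_eq_pair, true_and] at h
      rw [PExpr.code_inj a a' h.1, PExpr.code_inj b b' h.2]
    | _ => simp [PExpr.code, Nat.pair_eq_pair] at h
  | .mul a b, f, h => by
    cases f with
    | mul a' b' =>
      simp only [PExpr.code, Nat.pair_eq_pair, true_and] at h
      rw [PExpr.code_inj a a' h.1, PExpr.code_inj b b' h.2]
    | _ => simp [PExpr.code, Nat.pair_eq_pair] at h

end

end WMLO

namespace WMLO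

open MeasureTheory

/-! ### A fair coin -/

-- The halting problem reduces to model checking on one fixed chain, the fair coin. There `n` given
-- tosses all show heads with probability `2⁻ⁿ`, which determines `n`. So the linear comparison
-- Pr(heads on `[t, v)`) - Pr(heads on `[0, u)`) = 0, together with `t ≤ v`, says `v = t + u`
-- (`sat_sum`). Since the variables inside the probability terms can be quantified from outside,
-- addition on ℕ becomes definable; this is the only use of probability.
--
-- Weak second-order quantification does the rest. A finite set of multiples witnesses divisibility;
-- divisibility gives `b * (b + 1)` as the least positive common multiple of `b` and `b + 1`; this
-- product and addition give `Nat.pair`. A finite set of coded pairs is then a table of a primitive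
-- recursion, so every partial recursive function has a definable graph (`Definable.mem_partrec`).
--
-- Hence some formula with one free time variable defines the set of programs that halt on input
-- `0`. Replacing the variable by a numeral yields sentences whose codes are computable from the
-- numeral, so a decision procedure would solve the halting problem. No agent operator occurs, so
-- neither `k` nor the recall matters.

/-- Independent tosses of a fair coin; the atomic proposition `0` marks the state `1`. -/
def coin (k : ℕ) : PODTMC k where
  numStates := 2
  PI _ := 1 / 2
  PI_nonneg _ := by norm_num
  PI_sum := by norm_num
  PT _ _ := 1 / 2
  PT_nonneg _ _ := by norm_num
  PT_sum _ := by norm_num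
  obs _ _ := 0
  interp s := if s = 1 then {0} else ∅

/-- `Models` quantifies over all runs, so truth of a run-independent sentence can be read off only
if a run exists. -/
instance (k : ℕ) : Nonempty (coin k).Path :=
  ⟨⟨fun _ => (0 : Fin 2), by simp [coin], fun _ => by simp [coin]⟩⟩

theorem coin_seqMeasure_prefix {k : ℕ} (ρ : ℕ → Fin 2) (m : ℕ) :
    (coin k).seqMeasure {ω : ℕ → Fin 2 | ∀ j ≤ m, ω j = ρ j} = (2⁻¹ : ENNReal) ^ (m + 1) := by
  refine ((coin k).seqMeasure_cylinder ρ m).trans ?_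
  have h : ((coin k).PI (ρ 0) * ∏ j ∈ Finset.range m, (coin k).PT (ρ j) (ρ (j + 1)) : ℚ) =
      (2⁻¹) ^ (m + 1) := by
    simp [coin, pow_succ']
  rw [h]
  push_cast
  rw [ENNReal.ofReal_pow (by norm_num), ENNReal.ofReal_inv_of_pos (by norm_num)]
  simp

/-- The event is the disjoint union, over the `2 ^ a` outcomes of the tosses before `a`, of
cylinders of measure `2⁻ᶜ`. -/
theorem coin_seqMeasure_Ico {k : ℕ} (a c : ℕ) (h : a ≤ c) :
    (coin k).seqMeasure {ω : ℕ → Fin 2 | ∀ t, a ≤ t → t < c → ω t = 1} =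
      (2⁻¹ : ENNReal) ^ (c - a) := by
  rcases h.eq_or_lt with rfl | hlt
  · have : {ω : ℕ → Fin 2 | ∀ t, a ≤ t → t < a → ω t = 1} = Set.univ := by
      ext ω
      simp only [Set.mem_ofPred_eq, Set.mem_univ, iff_true]
      intro t h1 h2
      omega
    rw [Nat.sub_self, pow_zero]
    exact (congrArg (coin k).seqMeasure this).trans measure_univ
  -- Cylinders fix the coordinates `0, …, m`, hence at least one; this is why the empty interval is
  -- treated separately.
  obtain ⟨m, rfl⟩ : ∃ m, c = m + 1 := ⟨c - 1, by omega⟩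
  let ext : (Fin a → Fin 2) → ℕ → Fin 2 := fun g j => if hj : j < a then g ⟨j, hj⟩ else 1
  have hU : {ω : ℕ → Fin 2 | ∀ t, a ≤ t → t < m + 1 → ω t = 1} =
      ⋃ g, {ω : ℕ → Fin 2 | ∀ j ≤ m, ω j = ext g j} := by
    ext ω
    simp only [Set.mem_ofPred_eq, Set.mem_iUnion, ext]
    constructor
    · intro h1
      refine ⟨fun j => ω j, fun j hj => ?_⟩
      split_ifs with hja
      · rfl
      · exact h1 j (by omega) (by omega)
    · rintro ⟨g, hg⟩ t h1 h2
      rw [hg t (by omega), dif_neg (by omega)]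
  have hd : Pairwise (Function.onFun Disjoint
      fun g => {ω : ℕ → Fin 2 | ∀ j ≤ m, ω j = ext g j}) := by
    intro g g' hne
    refine Set.disjoint_left.2 fun ω h1 h2 => hne ?_
    funext j
    have e := (h1 j (by omega)).symm.trans (h2 j (by omega))
    simpa [ext] using e
  have hm : ∀ g, MeasurableSet {ω : ℕ → Fin 2 | ∀ j ≤ m, ω j = ext g j} := by
    intro g
    measurability
  refine (congrArg (coin k).seqMeasure hU).trans ((measure_iUnion hd hm).trans
    ((tsum_congr fun g => coin_seqMeasure_prefix (k := k) (ext g) m).trans ?_))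
  rw [tsum_fintype]
  simp only [Finset.sum_const, Finset.card_univ, Fintype.card_fun, Fintype.card_fin, nsmul_eq_mul]
  have e : m + 1 = a + (m + 1 - a) := by omega
  rw [e, pow_add, ← mul_assoc, Nat.add_sub_cancel_left]
  push_cast
  rw [← mul_pow, ENNReal.mul_inv_cancel (by simp) (by simp), one_pow, one_mul]

theorem coin_pathMeasure_Ico {k : ℕ} (a c : ℕ) (h : a ≤ c) :
    (coin k).pathMeasure.real {ρ | ∀ t, a ≤ t → t < c → ρ.1 t = (1 : Fin 2)} =
      (2⁻¹ : ℝ) ^ (c - a) := by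
  have h1 := (coin k).pathMeasure_apply {ω : ℕ → Fin 2 | ∀ t, a ≤ t → t < c → ω t = 1}
  rw [coin_seqMeasure_Ico a c h] at h1
  refine (congrArg ENNReal.toReal h1).trans ?_
  simp

/-! ### Derived connectives -/

namespace Formula

variable {k : ℕ} (M : PODTMC k) (x : Recall)

def imp (φ ψ : Formula k) : Formula k := .neg (.and φ (.neg ψ))

theorem sat_imp (φ ψ : Formula k) (τ : Assignment) (ρ : M.Path) :
    (φ.imp ψ).Sat M x τ ρ ↔ (φ.Sat M x τ ρ → ψ.Sat M x τ ρ) := by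
  simp [imp, Sat]

/-- The formula `∀ z, ¬ z < t → z < u → p(z)`, where `p` is the atomic proposition `0`. -/
def allHeads (z t u : ℕ) : Formula k :=
  .allTime z (.imp (.neg (.lt z t)) (.imp (.lt z u) (.prop 0 z)))

/-- The formula `∀ z, z < u → p(z)`, where `p` is the atomic proposition `0`. -/
def allHeadsBelow (z u : ℕ) : Formula k :=
  .allTime z (.imp (.lt z u) (.prop 0 z))

end Formula

theorem Assignment.time_updTime (τ : Assignment) (t n : ℕ) :
    (τ.updTime t n).time = Function.update τ.time t n := rfl

theorem Assignment.set_updTime (τ : Assignment) (t n : ℕ) : (τ.updTime t n).set = τ.set := rfl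

theorem Assignment.time_updSet (τ : Assignment) (X : ℕ) (U : Finset ℕ) :
    (τ.updSet X U).time = τ.time := rfl

theorem Assignment.set_updSet (τ : Assignment) (X : ℕ) (U : Finset ℕ) :
    (τ.updSet X U).set = Function.update τ.set X U := rfl

theorem coin_mem_interp {k : ℕ} (s : Fin 2) : 0 ∈ (coin k).interp s ↔ s = 1 := by
  by_cases h : s = 1 <;> simp [coin, h]

theorem sat_allHeads {k : ℕ} (x : Recall) {z t u : ℕ} (ht : t ≠ z) (hu : u ≠ z) (τ : Assignment)
    (ρ : (coin k).Path) : (Formula.allHeads z t u).Sat (coin k) x τ ρ ↔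
      ∀ n, τ.time t ≤ n → n < τ.time u → ρ.1 n = (1 : Fin 2) := by
  simp only [Formula.allHeads, Formula.Sat, Formula.sat_imp, Assignment.time_updTime,
    Function.update_self, Function.update_of_ne ht, Function.update_of_ne hu, not_lt]
  exact forall_congr' fun n => imp_congr_right fun _ => imp_congr_right fun _ => coin_mem_interp _

theorem sat_allHeadsBelow {k : ℕ} (x : Recall) {z u : ℕ} (hu : u ≠ z) (τ : Assignment)
    (ρ : (coin k).Path) : (Formula.allHeadsBelow z u).Sat (coin k) x τ ρ ↔
      ∀ n, 0 ≤ n → n < τ.time u → ρ.1 n = (1 : Fin 2) := by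
  simp only [Formula.allHeadsBelow, Formula.Sat, Formula.sat_imp, Assignment.time_updTime,
    Function.update_self, Function.update_of_ne hu]
  exact forall_congr' fun n => ⟨fun h _ hn => (coin_mem_interp _).1 (h hn),
    fun h hn => (coin_mem_interp _).2 (h n.zero_le hn)⟩

-- Addition from coin probabilities

/-- The formula `t + u = v`: the probabilities that all tosses from `t` to `v` show heads and that
the first `u` tosses show heads agree. -/
def Formula.sum {k : ℕ} (z t u v : ℕ) : Formula k :=
  .and (.neg (.lt v t))
    (.cmp (.add (.pr (.allHeads z t v)) (.mul (.const (-1)) (.pr (.allHeadsBelow z u)))) .eq 0)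

/-- For `t ≤ v` the two probabilities are `2⁻¹` to the powers `v - t` and `u`, and powers of `2⁻¹`
are injective in the exponent. The conjunct `t ≤ v` is needed: for `v < t` the interval is empty and
has probability `1`, which agrees with `u = 0`. -/
theorem sat_sum {k : ℕ} (x : Recall) {z t u v : ℕ} (ht : t ≠ z) (hu : u ≠ z) (hv : v ≠ z)
    (τ : Assignment) (ρ : (coin k).Path) : (Formula.sum z t u v).Sat (coin k) x τ ρ ↔
      τ.time v = τ.time t + τ.time u := by
  simp only [Formula.sum, Formula.Sat, PExpr.val, Cmp.Holds, sat_allHeads x ht hv,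
    sat_allHeadsBelow x hu, not_lt]
  have key : τ.time t ≤ τ.time v →
      (((coin k).pathMeasure.real
          {ρ' | ∀ n, τ.time t ≤ n → n < τ.time v → ρ'.1 n = (1 : Fin 2)} +
        ((-1 : ℚ) : ℝ) * (coin k).pathMeasure.real
          {ρ' | ∀ n, 0 ≤ n → n < τ.time u → ρ'.1 n = (1 : Fin 2)} = ((0 : ℚ) : ℝ)) ↔
        τ.time v - τ.time t = τ.time u) := by
    intro h
    rw [coin_pathMeasure_Ico _ _ h, coin_pathMeasure_Ico _ _ (Nat.zero_le _), Nat.sub_zero]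
    push_cast
    rw [neg_one_mul, add_neg_eq_zero]
    exact pow_right_inj₀ (by norm_num) (by norm_num)
  constructor
  · rintro ⟨h1, h2⟩
    have := (key h1).1 h2
    omega
  · intro h
    exact ⟨by omega, (key (by omega)).2 (by omega)⟩

/-! ### Definable relations -/

/-- A relation between `n` natural numbers and `m` finite sets is definable if, for all choices of
variables, a formula of the fragment expresses it on the fair coin. -/
def Definable (k : ℕ) (x : Recall) {n m : ℕ}
    (P : (Fin n → ℕ) → (Fin m → Finset ℕ) → Prop) : Prop :=
  ∀ (v : Fin n → ℕ) (w : Fin m → ℕ), ∃ φ : Formula k, φ.LinearGlobal ∧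
    ∀ τ ρ, φ.Sat (coin k) x τ ρ ↔ P (fun i => τ.time (v i)) (fun j => τ.set (w j))

namespace Definable

variable {k : ℕ} {x : Recall} {n m : ℕ} {P Q : (Fin n → ℕ) → (Fin m → Finset ℕ) → Prop}

theorem of_iff (h : Definable k x P) (e : ∀ a s, Q a s ↔ P a s) : Definable k x Q := fun v w =>
  let ⟨φ, h1, h2⟩ := h v w
  ⟨φ, h1, fun τ ρ => (h2 τ ρ).trans (e _ _).symm⟩

theorem mem (i : Fin n) (j : Fin m) : Definable k x (fun a s => a i ∈ s j) := fun v w =>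
  ⟨.mem (w j) (v i), trivial, fun τ ρ => by simp [Formula.Sat]⟩

theorem lt (i j : Fin n) : Definable k x (fun a (_ : Fin m → Finset ℕ) => a i < a j) := fun v _ =>
  ⟨.lt (v i) (v j), trivial, fun τ ρ => by simp [Formula.Sat]⟩

theorem not (h : Definable k x P) : Definable k x (fun a s => ¬ P a s) := fun v w =>
  let ⟨φ, h1, h2⟩ := h v w
  ⟨.neg φ, h1, fun τ ρ => by simp [Formula.Sat, h2]⟩

theorem and (hP : Definable k x P) (hQ : Definable k x Q) :
    Definable k x (fun a s => P a s ∧ Q a s) := fun v w =>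
  let ⟨φ, h1, h2⟩ := hP v w
  let ⟨ψ, h3, h4⟩ := hQ v w
  ⟨.and φ ψ, ⟨h1, h3⟩, fun τ ρ => by simp [Formula.Sat, h2, h4]⟩

theorem or (hP : Definable k x P) (hQ : Definable k x Q) :
    Definable k x (fun a s => P a s ∨ Q a s) :=
  (hP.not.and hQ.not).not.of_iff fun _ _ => by tauto

theorem imp (hP : Definable k x P) (hQ : Definable k x Q) :
    Definable k x (fun a s => P a s → Q a s) :=
  (hP.and hQ.not).not.of_iff fun _ _ => by tauto

/-- Definability asks for a formula for every choice of variables, so a bound variable can always be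
taken fresh and no substitution into formulas is needed. -/
theorem exists_fresh {n : ℕ} (v : Fin n → ℕ) : ∃ z, ∀ i, v i ≠ z := by
  obtain ⟨z, hz⟩ := Infinite.exists_notMem_finset (Finset.univ.image v)
  exact ⟨z, fun i hi => hz (by simp [← hi])⟩

/-- The bound variable becomes coordinate `0` and the other coordinates move up by one, as with de
Bruijn indices. -/
theorem allTime {P : (Fin n → ℕ) → (Fin m → Finset ℕ) → ℕ → Prop}
    (h : Definable k x (fun (a : Fin (n + 1) → ℕ) s => P (fun i => a i.succ) s (a 0))) :
    Definable k x (fun a s => ∀ y, P a s y) := fun v w => by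
  obtain ⟨z, hz⟩ := exists_fresh v
  obtain ⟨φ, h1, h2⟩ := h (Fin.cons z v) w
  refine ⟨.allTime z φ, h1, fun τ ρ => ?_⟩
  simp [Formula.Sat, h2, Assignment.time_updTime, Assignment.set_updTime,
    Function.update_of_ne (hz _)]

theorem exTime {P : (Fin n → ℕ) → (Fin m → Finset ℕ) → ℕ → Prop}
    (h : Definable k x (fun (a : Fin (n + 1) → ℕ) s => P (fun i => a i.succ) s (a 0))) :
    Definable k x (fun a s => ∃ y, P a s y) :=
  (allTime (P := fun a s y => ¬ P a s y) h.not).not.of_iff fun _ _ => by push Not; rfl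

theorem exSet {P : (Fin n → ℕ) → (Fin m → Finset ℕ) → Finset ℕ → Prop}
    (h : Definable k x (fun a (s : Fin (m + 1) → Finset ℕ) => P a (fun i => s i.succ) (s 0))) :
    Definable k x (fun a s => ∃ y, P a s y) := fun v w => by
  obtain ⟨z, hz⟩ := exists_fresh w
  obtain ⟨φ, h1, h2⟩ := h v (Fin.cons z w)
  refine ⟨.neg (.allSet z (.neg φ)), h1, fun τ ρ => ?_⟩
  simp [Formula.Sat, h2, Assignment.time_updSet, Assignment.set_updSet,
    Function.update_of_ne (hz _)]

-- Definable arithmetic, up to the pairing function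

theorem add (i j l : Fin n) :
    Definable k x (fun a (_ : Fin m → Finset ℕ) => a l = a i + a j) := fun v _ => by
  obtain ⟨z, hz⟩ := exists_fresh v
  exact ⟨.sum z (v i) (v j) (v l), by
    simp [Formula.sum, Formula.LinearGlobal, PExpr.LinearGlobal, Formula.allHeads,
      Formula.allHeadsBelow, Formula.imp], fun τ ρ => sat_sum x (hz _) (hz _) (hz _) τ ρ⟩

theorem eq (i j : Fin n) : Definable k x (fun a (_ : Fin m → Finset ℕ) => a i = a j) :=
  ((lt i j).not.and (lt j i).not).of_iff fun _ _ => by omega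

theorem eq_zero (i : Fin n) : Definable k x (fun a (_ : Fin m → Finset ℕ) => a i = 0) :=
  (add i i i).of_iff fun _ _ => by omega

theorem eq_succ (i j : Fin n) : Definable k x (fun a (_ : Fin m → Finset ℕ) => a j = a i + 1) := by
  refine Definable.of_iff (P := fun a _ => a i < a j ∧ ∀ u, ¬ (a i < u ∧ u < a j)) ?_ ?_
  · exact .and (.lt _ _) (.allTime (.not (.and (.lt _ _) (.lt _ _))))
  · intro a _
    constructor
    · intro h
      exact ⟨by omega, fun u => by omega⟩
    · rintro ⟨h1, h2⟩
      have := h2 (a i + 1)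
      omega

/-- Divisibility, witnessed by a finite set of multiples that is closed under subtraction. -/
theorem dvd (i j : Fin n) : Definable k x (fun a (_ : Fin m → Finset ℕ) => a i ∣ a j) := by
  -- The condition `r < u` makes the descent terminate. Without it, every element could justify
  -- itself when `a i = 0`.
  refine Definable.of_iff (P := fun a _ => ∃ X : Finset ℕ, a j ∈ X ∧
    ∀ u, u ∈ X → u = 0 ∨ ∃ r, r ∈ X ∧ r < u ∧ u = r + a i) ?_ ?_
  · exact .exSet (.and (.mem _ _) (.allTime (.imp (.mem _ _) (.or (.eq_zero _)
      (.exTime (.and (.mem _ _) (.and (.lt _ _) (.add _ _ _))))))))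
  · intro a _
    constructor
    · rintro ⟨q, hq⟩
      rcases (a i).eq_zero_or_pos with h0 | h0
      · exact ⟨{0}, by simp [hq, h0], by simp⟩
      · refine ⟨(Finset.range (q + 1)).image (a i * ·),
          Finset.mem_image.2 ⟨q, by simp, hq.symm⟩, ?_⟩
        simp only [Finset.mem_image, Finset.mem_range]
        rintro u ⟨c, hc, rfl⟩
        rcases c with _ | c
        · simp
        · exact .inr ⟨a i * c, ⟨c, by omega, rfl⟩, by rw [mul_add]; omega, by ring⟩
    · rintro ⟨X, hj, hX⟩
      suffices ∀ u, u ∈ X → a i ∣ u from this _ hj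
      intro u
      induction u using Nat.strong_induction_on with
      | _ u ih =>
        intro hu
        rcases hX u hu with h | ⟨r, hr, hlt, h⟩
        · simp [h]
        · rw [h]
          exact (ih r hlt hr).add (dvd_refl _)

/-- Consecutive numbers are coprime, so their least positive common multiple is their product. For
`b = 0` there is no positive common multiple, hence the separate case. -/
theorem eq_mul_succ_iff (b y : ℕ) : y = b * (b + 1) ↔ (b = 0 ∧ y = 0) ∨ (¬ b = 0 ∧
    ∃ c, c = b + 1 ∧ ¬ y = 0 ∧ b ∣ y ∧ c ∣ y ∧ ∀ z, z < y → ¬ z = 0 → b ∣ z → ¬ c ∣ z) := by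
  have hc : Nat.Coprime b (b + 1) := by simp
  rcases b.eq_zero_or_pos with rfl | hb
  · simp
  simp only [hb.ne', false_and, not_false_eq_true, true_and, false_or, exists_eq_left]
  constructor
  · rintro rfl
    refine ⟨by positivity, dvd_mul_right _ _, dvd_mul_left _ _, fun z hz h0 h1 h2 => ?_⟩
    exact absurd (Nat.le_of_dvd (Nat.pos_of_ne_zero h0) (hc.mul_dvd_of_dvd_of_dvd h1 h2))
      (by omega)
  · rintro ⟨h0, h1, h2, h3⟩
    have hd := hc.mul_dvd_of_dvd_of_dvd h1 h2
    rcases (Nat.le_of_dvd (Nat.pos_of_ne_zero h0) hd).eq_or_lt with h | h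
    · exact h.symm
    · exact absurd (dvd_mul_left _ _) (h3 _ h (by positivity) (dvd_mul_right _ _))

theorem eq_mul_succ (i j : Fin n) :
    Definable k x (fun a (_ : Fin m → Finset ℕ) => a j = a i * (a i + 1)) := by
  refine Definable.of_iff ?_ fun a _ => eq_mul_succ_iff (a i) (a j)
  exact .or (.and (.eq_zero _) (.eq_zero _)) (.and (.not (.eq_zero _)) (.exTime
    (.and (.eq_succ _ _) (.and (.not (.eq_zero _)) (.and (.dvd _ _) (.and (.dvd _ _)
      (.allTime (.imp (.lt _ _) (.imp (.not (.eq_zero _)) (.imp (.dvd _ _)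
        (.not (.dvd _ _))))))))))))

/-- `Nat.pair a b` is `b * b + a` if `a < b`, and `a * a + a + b` otherwise. Adding `b` in the first
case turns the square into `b * (b + 1)`, so general multiplication is not required. -/
theorem eq_pair (i j l : Fin n) :
    Definable k x (fun a (_ : Fin m → Finset ℕ) => a l = Nat.pair (a i) (a j)) := by
  refine Definable.of_iff (P := fun a _ =>
    (a i < a j ∧ ∃ y, y = a j * (a j + 1) ∧ ∃ s, s = a l + a j ∧ s = y + a i) ∨
      (¬ a i < a j ∧ ∃ y, y = a i * (a i + 1) ∧ a l = y + a j)) ?_ ?_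
  · exact .or (.and (.lt _ _) (.exTime (.and (.eq_mul_succ _ _) (.exTime
      (.and (.add _ _ _) (.add _ _ _)))))) (.and (.not (.lt _ _)) (.exTime
      (.and (.eq_mul_succ _ _) (.add _ _ _))))
  · intro a _
    simp only [exists_eq_left]
    rw [Nat.pair]
    split_ifs with h
    · simp only [h, not_true_eq_false, false_and, or_false, true_and]
      rw [mul_add]
      omega
    · simp only [h, not_false_eq_true, false_and, false_or, true_and]
      rw [mul_add]
      omega

end Definable
end WMLO
namespace WMLO

/-! ### Partial recursive functions have definable graphs -/

namespace Definable

variable {k : ℕ} {x : Recall}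

/-- `U` is a computation table whose entries `(i, v)` are each justified by the base case or by an
entry at `i - 1`. It need not be single-valued or minimal: induction on the first component shows
that every entry is correct. -/
theorem mem_prec_iff (f g : ℕ →. ℕ) (a n y : ℕ) :
    y ∈ (Nat.rec (f a) (fun i IH => do let v ← IH; g (Nat.pair a (Nat.pair i v))) n : Part ℕ) ↔
      ∃ U : Finset ℕ, Nat.pair n y ∈ U ∧ ∀ i v, Nat.pair i v ∈ U → (i = 0 ∧ v ∈ f a) ∨
        ∃ j w, i = j + 1 ∧ Nat.pair j w ∈ U ∧ v ∈ g (Nat.pair a (Nat.pair j w)) := by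
  constructor
  · induction n generalizing y with
    | zero =>
      intro h
      refine ⟨{Nat.pair 0 y}, by simp, fun i v hi => .inl ?_⟩
      rw [Finset.mem_singleton, Nat.pair_eq_pair] at hi
      exact ⟨hi.1, hi.2 ▸ h⟩
    | succ n ih =>
      intro h
      obtain ⟨w, hw, hy⟩ := Part.mem_bind_iff.1 h
      obtain ⟨U, hU, h2⟩ := ih w hw
      refine ⟨insert (Nat.pair (n + 1) y) U, Finset.mem_insert_self _ _, fun i v hi => ?_⟩
      rcases Finset.mem_insert.1 hi with hi | hi
      · rw [Nat.pair_eq_pair] at hi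
        exact .inr ⟨n, w, hi.1, Finset.mem_insert_of_mem hU, hi.2 ▸ hy⟩
      · exact (h2 i v hi).imp_right fun ⟨j, w, h3, h4, h5⟩ =>
          ⟨j, w, h3, Finset.mem_insert_of_mem h4, h5⟩
  · rintro ⟨U, hU, h⟩
    induction n generalizing y with
    | zero =>
      rcases h _ _ hU with h1 | ⟨j, w, h1, -⟩
      · exact h1.2
      · omega
    | succ n ih =>
      rcases h _ _ hU with h1 | ⟨j, w, h1, h2, h3⟩
      · omega
      · obtain rfl : n = j := by omega
        exact Part.mem_bind_iff.2 ⟨w, ih w h2, h3⟩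

/-- Induction on the generation of `f`. The numbers of variables stay universally quantified because
the induction hypotheses are used under additional quantifiers. Codes of pairs get variables of
their own, as the logic has no function terms. -/
theorem mem_partrec {f : ℕ →. ℕ} (hf : Nat.Partrec f) : ∀ {n m : ℕ} (i j : Fin n),
    Definable k x (fun a (_ : Fin m → Finset ℕ) => a j ∈ f (a i)) := by
  induction hf with
  | zero =>
    intro n m i j
    exact (eq_zero j).of_iff fun _ _ => Part.mem_some_iff
  | succ =>
    intro n m i j
    exact (eq_succ i j).of_iff fun _ _ => Part.mem_some_iff
  | left =>
    intro n m i j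
    refine Definable.of_iff (P := fun a _ => ∃ u, a i = Nat.pair (a j) u)
      (.exTime (.eq_pair _ _ _)) fun a _ => Part.mem_some_iff.trans ⟨?_, ?_⟩
    · intro h
      exact ⟨(a i).unpair.2, by rw [h, Nat.pair_unpair]⟩
    · rintro ⟨u, hu⟩
      simp only [hu, Nat.unpair_pair]
  | right =>
    intro n m i j
    refine Definable.of_iff (P := fun a _ => ∃ u, a i = Nat.pair u (a j))
      (.exTime (.eq_pair _ _ _)) fun a _ => Part.mem_some_iff.trans ⟨?_, ?_⟩
    · intro h
      exact ⟨(a i).unpair.1, by rw [h, Nat.pair_unpair]⟩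
    · rintro ⟨u, hu⟩
      simp only [hu, Nat.unpair_pair]
  | @pair f g _ _ ihf ihg =>
    intro n m i j
    refine Definable.of_iff (P := fun a _ => ∃ u, u ∈ f (a i) ∧ ∃ v, v ∈ g (a i) ∧
      a j = Nat.pair u v) (.exTime (.and (ihf _ _) (.exTime (.and (ihg _ _) (.eq_pair _ _ _)))))
      fun a _ => ?_
    simp [Seq.seq, eq_comm]
  | @comp f g _ _ ihf ihg =>
    intro n m i j
    exact Definable.of_iff (P := fun a _ => ∃ u, u ∈ g (a i) ∧ a j ∈ f u)
      (.exTime (.and (ihg _ _) (ihf _ _))) fun a _ => Part.mem_bind_iff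
  | @prec f g _ _ ihf ihg =>
    intro n m i j
    refine Definable.of_iff (P := fun a _ => ∃ b r, a i = Nat.pair b r ∧ ∃ U : Finset ℕ,
      (∃ p, p = Nat.pair r (a j) ∧ p ∈ U) ∧ ∀ i v p, p = Nat.pair i v → p ∈ U →
        (i = 0 ∧ v ∈ f b) ∨ ∃ j w q t, i = j + 1 ∧ q = Nat.pair j w ∧ q ∈ U ∧
          t = Nat.pair b q ∧ v ∈ g t) ?_ ?_
    · exact .exTime (.exTime (.and (.eq_pair _ _ _) (.exSet (.and
        (.exTime (.and (.eq_pair _ _ _) (.mem _ _)))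
        (.allTime (.allTime (.allTime (.imp (.eq_pair _ _ _) (.imp (.mem _ _)
          (.or (.and (.eq_zero _) (ihf _ _))
            (.exTime (.exTime (.exTime (.exTime (.and (.eq_succ _ _) (.and (.eq_pair _ _ _)
              (.and (.mem _ _) (.and (.eq_pair _ _ _) (ihg _ _)))))))))))))))))))
    · intro a _
      refine (mem_prec_iff f g (a i).unpair.1 (a i).unpair.2 (a j)).trans ?_
      constructor
      · rintro ⟨U, h1, h2⟩
        refine ⟨_, _, (Nat.pair_unpair _).symm, U, ⟨_, rfl, h1⟩, ?_⟩
        rintro i v _ rfl hU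
        exact (h2 i v hU).imp_right fun ⟨j, w, h3, h4, h5⟩ => ⟨j, w, _, _, h3, rfl, h4, rfl, h5⟩
      · rintro ⟨b, r, hbr, U, ⟨_, rfl, h1⟩, h2⟩
        rw [hbr, Nat.unpair_pair]
        refine ⟨U, h1, fun i v hU => (h2 i v _ rfl hU).imp_right ?_⟩
        rintro ⟨j, w, _, _, h3, rfl, h4, rfl, h5⟩
        exact ⟨j, w, h3, h4, h5⟩
  | @rfind f _ ih =>
    intro n m i j
    -- Minimization requires `f` to be defined at all smaller arguments, so a nonzero value must
    -- exist there; it does not suffice that `0` is not a value.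
    refine Definable.of_iff (P := fun a _ =>
      (∃ p, p = Nat.pair (a i) (a j) ∧ ∃ z, z = 0 ∧ z ∈ f p) ∧
        ∀ u, u < a j → ∃ p, p = Nat.pair (a i) u ∧ ∃ z, ¬ z = 0 ∧ z ∈ f p) ?_ ?_
    · exact .and (.exTime (.and (.eq_pair _ _ _) (.exTime (.and (.eq_zero _) (ih _ _)))))
        (.allTime (.imp (.lt _ _) (.exTime (.and (.eq_pair _ _ _)
          (.exTime (.and (.not (.eq_zero _)) (ih _ _)))))))
    · intro a _
      refine Nat.mem_rfind.trans ?_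
      simp [and_comm]

end Definable

/-! ### Sentences -/

namespace Formula

variable {k : ℕ} (M : PODTMC k) (x : Recall)

/-- Universal quantification over free variables whose values do not matter. -/
theorem exists_close {P : ℕ → Prop} (s t : Finset ℕ) : ∀ φ : Formula k, φ.LinearGlobal →
    (∀ τ ρ, φ.Sat M x τ ρ ↔ P (τ.time 0)) → φ.freeTime ⊆ insert 0 s → φ.freeSet ⊆ t →
    ∃ ψ : Formula k, ψ.LinearGlobal ∧ (∀ τ ρ, ψ.Sat M x τ ρ ↔ P (τ.time 0)) ∧
      ψ.freeTime ⊆ {0} ∧ ψ.freeSet = ∅ := by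
  induction s using Finset.induction_on with
  | empty =>
    induction t using Finset.induction_on with
    | empty => exact fun φ h1 h2 h3 h4 => ⟨φ, h1, h2, h3, Finset.subset_empty.1 h4⟩
    | insert X t _ ih =>
      intro φ h1 h2 h3 h4
      refine ih (.allSet X φ) h1 (fun τ ρ => ?_) h3 (Finset.subset_insert_iff.1 h4)
      simp [Sat, h2, Assignment.time_updSet]
  | insert u s _ ih =>
    intro φ h1 h2 h3 h4
    by_cases hu : u = 0
    · subst hu
      exact ih φ h1 h2 (by simpa using h3) h4
    · refine ih (.allTime u φ) h1 (fun τ ρ => ?_) ?_ h4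
      · simp [Sat, h2, Assignment.time_updTime, Function.update_of_ne (Ne.symm hu)]
      · rw [Finset.insert_comm] at h3
        exact Finset.subset_insert_iff.1 h3

/-- Given `φ(0)`, the formula expressing `φ(n)` for the `n`-th successor of the variable `0`. -/
def shift (φ : Formula k) : ℕ → Formula k
  | 0 => φ
  | n + 1 => .allTime 1 (.imp (.and (.lt 0 1) (.allTime 2 (.neg (.and (.lt 0 2) (.lt 2 1)))))
      (.allTime 0 (.imp (.and (.neg (.lt 0 1)) (.neg (.lt 1 0))) (φ.shift n))))

/-- Each step binds `1` to the successor of `0` and then rebinds `0` to that value. Overwriting `1`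
and `2` is harmless, since the truth of `φ` depends only on the value of `0`. -/
theorem sat_shift {P : ℕ → Prop} {φ : Formula k}
    (h : ∀ τ ρ, φ.Sat M x τ ρ ↔ P (τ.time 0)) (n : ℕ) (τ : Assignment) (ρ : M.Path) :
    (φ.shift n).Sat M x τ ρ ↔ P (τ.time 0 + n) := by
  induction n generalizing τ with
  | zero => exact h τ ρ
  | succ n ih =>
    simp only [shift, Sat, sat_imp, ih, Assignment.time_updTime, Function.update_self, ne_eq,
      OfNat.zero_ne_ofNat, OfNat.one_ne_ofNat,
      not_false_eq_true, Function.update_of_ne, one_ne_zero, zero_ne_one]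
    constructor
    · intro h1
      have h2 := h1 (τ.time 0 + 1) ⟨by omega, fun u => by omega⟩ (τ.time 0 + 1) (by omega)
      rwa [add_assoc, add_comm 1 n] at h2
    · rintro h1 u ⟨h2, h3⟩ v h4
      have h5 := h3 (τ.time 0 + 1)
      have : v + n = τ.time 0 + (n + 1) := by omega
      rwa [this]

/-- Given `φ(0)`, the formula expressing `φ(n)` for the number `n`. -/
def instantiate (φ : Formula k) (n : ℕ) : Formula k :=
  .allTime 0 (.imp (.allTime 1 (.neg (.lt 1 0))) (φ.shift n))

theorem sat_instantiate {P : ℕ → Prop} {φ : Formula k}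
    (h : ∀ τ ρ, φ.Sat M x τ ρ ↔ P (τ.time 0)) (n : ℕ) (τ : Assignment) (ρ : M.Path) :
    (φ.instantiate n).Sat M x τ ρ ↔ P n := by
  simp only [instantiate, Sat, sat_imp, sat_shift M x h, Assignment.time_updTime,
    Function.update_self, ne_eq, zero_ne_one, not_false_eq_true, Function.update_of_ne]
  constructor
  · intro h1
    simpa using h1 0 (by simp)
  · intro h1 u hu
    have := hu 0
    obtain rfl : u = 0 := by omega
    simpa using h1

theorem linearGlobal_shift {φ : Formula k} (h : φ.LinearGlobal) (n : ℕ) :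
    (φ.shift n).LinearGlobal := by
  induction n with
  | zero => exact h
  | succ n ih => simp [shift, imp, LinearGlobal, ih]

theorem linearGlobal_instantiate {φ : Formula k} (h : φ.LinearGlobal) (n : ℕ) :
    (φ.instantiate n).LinearGlobal := by
  simp [instantiate, imp, LinearGlobal, linearGlobal_shift h]

theorem freeTime_shift {φ : Formula k} (h : φ.freeTime ⊆ {0}) (n : ℕ) :
    (φ.shift n).freeTime ⊆ {0} := by
  induction n with
  | zero => exact h
  | succ n ih =>
    have := Finset.subset_iff.1 ih
    intro u
    simp only [shift, imp, freeTime, Finset.mem_erase, Finset.mem_union, Finset.mem_insert,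
      Finset.mem_singleton] at this ⊢
    grind

theorem isSentence_instantiate {φ : Formula k} (h1 : φ.freeTime ⊆ {0}) (h2 : φ.freeSet = ∅)
    (n : ℕ) : (φ.instantiate n).IsSentence := by
  constructor
  · rw [Finset.eq_empty_iff_forall_notMem]
    intro u
    have := @freeTime_shift _ _ h1 n u
    simp only [instantiate, imp, freeTime, Finset.mem_erase, Finset.mem_union, Finset.mem_insert,
      Finset.mem_singleton] at this ⊢
    grind
  · have : (φ.shift n).freeSet = ∅ := by
      induction n with
      | zero => exact h2
      | succ n ih => simp [shift, imp, freeSet, ih]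
    simp [instantiate, imp, freeSet, this]

/-- For fixed `φ`, passing from `φ.shift n` to `φ.shift (n + 1)` wraps the code in a fixed chain of
pairings with constants, so this is a primitive recursion on `n`. The tags `7`, `4`, `5` stand for
`allTime`, `neg`, `and`. -/
theorem primrec_code_instantiate (φ : Formula k) :
    Primrec fun n => (φ.instantiate n).code := by
  have pr : ∀ {α : Type} [Primcodable α] (c : ℕ) {f : α → ℕ}, Primrec f →
      Primrec fun a => Nat.pair c (f a) := fun c _ hf =>
    Primrec₂.natPair.comp (.const c) hf
  have h : Primrec fun n => (φ.shift n).code := by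
    refine (Primrec.nat_rec₁ φ.code (f := fun _ c => Nat.pair 7 (Nat.pair 1 (Nat.pair 4
      (Nat.pair 5 (Nat.pair (Formula.code (k := k)
        (.and (.lt 0 1) (.allTime 2 (.neg (.and (.lt 0 2) (.lt 2 1))))))
        (Nat.pair 4 (Nat.pair 7 (Nat.pair 0 (Nat.pair 4 (Nat.pair 5 (Nat.pair
          (Formula.code (k := k) (.and (.neg (.lt 0 1)) (.neg (.lt 1 0))))
          (Nat.pair 4 c))))))))))))
      (pr _ <| pr _ <| pr _ <| pr _ <| pr _ <| pr _ <| pr _ <| pr _ <| pr _ <| pr _ <| pr _ <|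
        pr _ Primrec.snd)).of_eq fun n => ?_
    induction n with
    | zero => rfl
    | succ n ih =>
      simp only [shift, imp, code, ← ih]
  exact (pr 7 <| pr 0 <| pr 4 <| pr 5 <|
    pr (Formula.code (k := k) (.allTime 1 (.neg (.lt 1 0)))) <| pr 4 h).of_eq fun n => by
      simp only [instantiate, imp, code]

end Formula

/-- On the coin, the instances of a suitable formula express the domain of a given partial recursive
function. -/
theorem exists_formula_dom (k : ℕ) (x : Recall) {f : ℕ →. ℕ} (hf : Nat.Partrec f) :
    ∃ φ : Formula k, (∀ n, (φ.instantiate n).LinearGlobal) ∧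
      (∀ n, (φ.instantiate n).IsSentence) ∧
      ∀ n, (coin k).Models x (φ.instantiate n) ↔ (f n).Dom := by
  have h : Definable k x (fun (a : Fin 1 → ℕ) (_ : Fin 0 → Finset ℕ) => ∃ y, y ∈ f (a 0)) :=
    .exTime (.mem_partrec hf _ _)
  obtain ⟨φ, h1, h2⟩ := h (fun _ => 0) Fin.elim0
  -- Definability controls only the meaning of `φ`, which may still contain irrelevant free
  -- variables; closing it leaves at most the time variable `0` free.
  obtain ⟨ψ, h3, h4, h5, h6⟩ := Formula.exists_close (coin k) x (P := fun n => ∃ y, y ∈ f n)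
    φ.freeTime φ.freeSet φ h1 h2 (Finset.subset_insert _ _) subset_rfl
  refine ⟨ψ, Formula.linearGlobal_instantiate h3, Formula.isSentence_instantiate h5 h6,
    fun n => ?_⟩
  simp only [PODTMC.Models, Formula.sat_instantiate (coin k) x (P := fun n => ∃ y, y ∈ f n) h4, Part.dom_iff_mem]
  exact ⟨fun h => h ⟨fun _ => 0, fun _ => ∅⟩ (Classical.arbitrary _), fun h _ _ => h⟩

end WMLO

-- Reduction from the halting problem

theorem theorem3 (k : ℕ) (x : WMLO.Recall) :
    ¬ ∃ d : (ℕ × List ℕ × List (List ℕ) × List (List ℕ) × List (List ℕ)) × ℕ →. Bool,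
      Partrec d ∧
        ∀ (M : WMLO.PODTMC k) (φ : WMLO.Formula k), φ.IsSentence → φ.LinearGlobal →
          ∃ b ∈ d (M.code, φ.code), (b = true ↔ M.Models x φ) := by
  rintro ⟨d, hd, h⟩
  -- The universal function at input `0`: its domain is the set of numbers of programs that halt on
  -- `0`.
  have hf : Nat.Partrec fun n => Nat.Partrec.Code.eval (Denumerable.ofNat _ n) 0 :=
    Partrec.nat_iff.1 (Nat.Partrec.Code.eval_part.comp (Computable.ofNat _) (Computable.const 0))
  obtain ⟨φ, h1, h2, h3⟩ := WMLO.exists_formula_dom k x hf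
  classical
  refine ComputablePred.halting_problem 0 ⟨fun _ => inferInstance, ?_⟩
  have hc : Partrec fun c : Nat.Partrec.Code =>
      d ((WMLO.coin k).code, (φ.instantiate (Encodable.encode c)).code) :=
    hd.comp ((Computable.const _).pair
      ((WMLO.Formula.primrec_code_instantiate φ).to_comp.comp Computable.encode))
  -- `d` may diverge on other inputs, but it answers on every sentence of the fragment, so the
  -- composite is total and equals the characteristic function of halting.
  refine hc.of_eq fun c => Part.eq_some_iff.2 ?_
  obtain ⟨b, hb, e⟩ := h (WMLO.coin k) _ (h2 (Encodable.encode c)) (h1 _)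
  rw [h3, Denumerable.ofNat_encode] at e
  convert hb
  exact Bool.eq_iff_iff.2 (decide_eq_true_iff.trans e.symm)
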